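/- A 3-uniform hypergraph is linear if any two distinct edges have at most one common vertex; a set $X$ of vertices spans the edges that are contained in $X$. For every sufficiently large $n$ there is a 3-uniform linear hypergraph on $n$ vertices with at least $n^{1.544}$ edges in which no nine vertices span five or more edges. Consequently, if $c$ is a real number such that every 3-uniform linear hypergraph on $n$ vertices in which no nine vertices span at least five edges has $O(n^{2-c})$ edges (the assertion of the Gowers–Long conjecture with constant $c$), then $c\le 0.456$. -/

import Mathlib

open Filter

/-- Every edge has exactly three vertices. -/
def Hypergraph.IsThreeUniform {α : Type*} (H : Hypergraph α) : Prop :=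
  ∀ e ∈ H.edgeSet, e.ncard = 3

/-- Any two distinct edges have at most one common vertex. -/
def Hypergraph.IsLinear {α : Type*} (H : Hypergraph α) : Prop :=
  ∀ e ∈ H.edgeSet, ∀ f ∈ H.edgeSet, e ≠ f → (e ∩ f).Subsingleton

/-- `H` has a set of nine vertices spanning (i.e. containing) at least five edges. -/
def Hypergraph.HasNineSpanningFive {α : Type*} (H : Hypergraph α) : Prop :=
  ∃ X ⊆ H.vertexSet, X.ncard = 9 ∧ 5 ≤ {e ∈ H.edgeSet | e ⊆ X}.ncard

/-- The hypergraphs on `n` vertices the conjecture is about: `H` has vertex set `Fin n`, is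
3-uniform and linear, and no nine of its vertices span five or more edges. -/
def IsGowersLongHypergraph (n : ℕ) (H : Hypergraph (Fin n)) : Prop :=
  H.vertexSet = Set.univ ∧ H.IsThreeUniform ∧ H.IsLinear ∧ ¬ H.HasNineSpanningFive

/-- The assertion of the Gowers–Long conjecture with the constant `c`: a 3-uniform linear
hypergraph on `n` vertices in which no nine vertices span at least five edges has
`O(n ^ (2 - c))` edges. -/
def GowersLongBound (c : ℝ) : Prop :=
  ∃ C : ℝ, ∀ᶠ n : ℕ in atTop, ∀ H : Hypergraph (Fin n), IsGowersLongHypergraph n H →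
    (H.edgeSet.ncard : ℝ) ≤ C * (n : ℝ) ^ (2 - c)

/-!
The lower bound comes from an explicit algebraic hypergraph. Let `G` be a finite abelian group and
let `a b : I → G`. Take three copies of `G` as the vertex set and the triples `x`, `x + a s`,
`x + b s` (one vertex in each copy) as edges, for `x : G` and `s : I`. This hypergraph is linear and
has no triangle (three edges meeting pairwise in three different vertices), and no two of its edges
have three transversals, provided that `a` and `b` satisfy a few implications between equations in
`G` (`IsSparsePair`). Such implications are inherited by coordinatewise powers
(`IsSparsePair.pi`), so one small example yields examples with `|G| ^ k` vertices in each part and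
`(|G| * |I|) ^ k` edges for all `k`. The four pairs `(0, 0)`, `(1, 4)`, `(2, 10)`, `(5, 6)` in
`ℤ/12` form such an example (`isSparsePair_offset`); its powers have `3 * 12 ^ k` vertices and
`48 ^ k` edges, and `log 48 / log 12 > 1.557`.

These properties exclude five edges on nine vertices (`IsSparse.ten_le_sum_card_image`). In a
linear hypergraph without triangles, five edges spanning at most nine vertices have at least six
pairs of meeting edges. If no vertex lies in three of them, the graph of meeting pairs is
triangle-free with six edges on five points, that is, `K_{2,3}`, and the two edges on the smaller
side have the other three as transversals in some order. A vertex in three of the edges makes the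
five edges span at least ten vertices. In the tripartite setting there are only finitely many
patterns of common vertices to inspect, and this is done by an exhaustive search (`search_five`).
-/

namespace Tripartite

/-! ### Five edges on nine vertices -/

/-- The names of the three vertices of an edge of a tripartite hypergraph, one in each part. Names
are compared only within the same part. -/
abbrev Triple := ℕ × ℕ × ℕ

/-- The number of vertices spanned by a list of edges. -/
def vertexCount (L : List Triple) : ℕ :=
  (L.map (·.1)).dedup.length + (L.map (·.2.1)).dedup.length + (L.map (·.2.2)).dedup.length

/-- Two edges with at least two common vertices. -/
def meetTwice (x y : Triple) : Bool :=
  (x.1 == y.1 && x.2.1 == y.2.1) || (x.2.1 == y.2.1 && x.2.2 == y.2.2) ||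
    (x.2.2 == y.2.2 && x.1 == y.1)

/-- Three edges such that consecutive ones meet in the first, the second and the third part. -/
def isTriangle (x y z : Triple) : Bool :=
  x.1 == y.1 && y.2.1 == z.2.1 && z.2.2 == x.2.2

/-- The edge `x` neither meets an edge of `L` twice nor forms a triangle with two edges of `L`. -/
def isCompatible (L : List Triple) (x : Triple) : Bool :=
  L.all fun y => !meetTwice x y && L.all fun z =>
    !isTriangle x y z && !isTriangle y z x && !isTriangle z x y

/-- Every vertex of `x` is joined by an edge of `L` to the vertex of `y` in the next part. -/
def hasTransversals (L : List Triple) (x y : Triple) : Bool :=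
  (L.any fun z => x.1 == z.1 && z.2.1 == y.2.1) &&
  (L.any fun z => x.2.1 == z.2.1 && z.2.2 == y.2.2) &&
  L.any fun z => x.2.2 == z.2.2 && z.1 == y.1

/-- The possible edges after those of `L`, up to the choice of names: in each part either an old
vertex or a new one, whose name is the length of `L`. -/
def candidates (L : List Triple) : List Triple :=
  (L.length :: (L.map (·.1)).dedup).product
    ((L.length :: (L.map (·.2.1)).dedup).product (L.length :: (L.map (·.2.2)).dedup))

/-- Exhaustive search: whenever `n` edges are added to `L`, each compatible with the previous ones,
and at most nine vertices are spanned all the time, there are two edges with three transversals. -/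
def search : ℕ → List Triple → Bool
  | 0, L => L.any fun x => L.any fun y => !(x == y) && hasTransversals L x y
  | n + 1, L => (candidates L).all fun x =>
      Nat.ble 10 (vertexCount (x :: L)) || !isCompatible L x || search n (x :: L)

/-- Five edges of a linear tripartite hypergraph without triangles span at least ten vertices unless
two of them have three transversals. -/
theorem search_five : search 5 [] = true := by decide +kernel

/-- A tripartite hypergraph, in which the edge `e` has the vertex `v c e` in the part `c`, that is
linear, has no triangle, and has no two edges `e ≠ f` with three transversals (edges joining the
vertex of `e` in each part to the vertex of `f` in the next part). Triangles and transversals are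
allowed to be degenerate here, so that these conditions pass to coordinatewise powers. -/
structure IsSparse {V E : Type*} (v : Fin 3 → E → V) : Prop where
  linear : ∀ c d, c ≠ d → ∀ e f, v c e = v c f → v d e = v d f → e = f
  triangle : ∀ e f g, v 0 e = v 0 f → v 1 f = v 1 g → v 2 g = v 2 e → e = f
  transversal : ∀ e f g₁ g₂ g₃, v 0 e = v 0 g₁ → v 1 g₁ = v 1 f → v 1 e = v 1 g₂ →
    v 2 g₂ = v 2 f → v 2 e = v 2 g₃ → v 0 g₃ = v 0 f → e = f

section Names

open Classical in
/-- The first index at which the sequence `u` takes its value at `i`. -/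
noncomputable def firstIndex {V : Type*} (u : ℕ → V) (i : ℕ) : ℕ :=
  Nat.find (p := fun j => u j = u i) ⟨i, rfl⟩

variable {V E : Type*}

theorem apply_firstIndex (u : ℕ → V) (i : ℕ) : u (firstIndex u i) = u i := by
  classical exact Nat.find_spec (p := fun j => u j = u i) ⟨i, rfl⟩

theorem firstIndex_le (u : ℕ → V) (i : ℕ) : firstIndex u i ≤ i := by
  classical exact Nat.find_min' (p := fun j => u j = u i) ⟨i, rfl⟩ rfl

theorem firstIndex_eq_iff {u : ℕ → V} {i j : ℕ} : firstIndex u i = firstIndex u j ↔ u i = u j := by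
  have key {i j : ℕ} (h : u i = u j) : firstIndex u i ≤ firstIndex u j := by
    classical
    exact Nat.find_min' (p := fun k => u k = u i) ⟨i, rfl⟩ ((apply_firstIndex u j).trans h.symm)
  refine ⟨fun h => ?_, fun h => (key h).antisymm (key h.symm)⟩
  rw [← apply_firstIndex u i, h, apply_firstIndex u j]

/-- A vertex of the edge number `n` is either new or the vertex of an earlier edge. -/
theorem firstIndex_eq_self_or (u : ℕ → V) (n : ℕ) :
    firstIndex u n = n ∨ ∃ i < n, firstIndex u i = firstIndex u n := by
  rcases (firstIndex_le u n).eq_or_lt with h | h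
  · exact .inl h
  · exact .inr ⟨_, h, firstIndex_eq_iff.2 (apply_firstIndex u n)⟩

/-- The vertices of the edge `e i`, each named by the index of the first edge containing it. -/
noncomputable def names (v : Fin 3 → E → V) (e : ℕ → E) (i : ℕ) : Triple :=
  (firstIndex (v 0 ∘ e) i, firstIndex (v 1 ∘ e) i, firstIndex (v 2 ∘ e) i)

/-- The edges `e i` with `i < n` in terms of the names of their vertices, the last one first. -/
noncomputable def namesList (v : Fin 3 → E → V) (e : ℕ → E) (n : ℕ) : List Triple :=
  (List.range n).reverse.map (names v e)

theorem namesList_succ (v : Fin 3 → E → V) (e : ℕ → E) (n : ℕ) :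
    namesList v e (n + 1) = names v e n :: namesList v e n := by
  simp [namesList, List.range_succ]

theorem length_namesList (v : Fin 3 → E → V) (e : ℕ → E) (n : ℕ) :
    (namesList v e n).length = n := by
  simp [namesList]

theorem mem_namesList {v : Fin 3 → E → V} {e : ℕ → E} {n : ℕ} {x : Triple} :
    x ∈ namesList v e n ↔ ∃ i < n, names v e i = x := by
  simp [namesList]

theorem vertexCount_eq (L : List Triple) : vertexCount L =
    (L.map (·.1)).toFinset.card + (L.map (·.2.1)).toFinset.card +
      (L.map (·.2.2)).toFinset.card := by
  simp only [vertexCount, List.card_toFinset]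

theorem vertexCount_mono {L M : List Triple} (h : L ⊆ M) : vertexCount L ≤ vertexCount M := by
  have key (f : Triple → ℕ) : (L.map f).toFinset.card ≤ (M.map f).toFinset.card := by
    refine Finset.card_le_card fun x hx => ?_
    simp only [List.mem_toFinset, List.mem_map] at hx ⊢
    exact hx.imp fun y hy => ⟨h hy.1, hy.2⟩
  rw [vertexCount_eq, vertexCount_eq]
  exact add_le_add (add_le_add (key _) (key _)) (key _)

theorem namesList_subset (v : Fin 3 → E → V) (e : ℕ → E) {m n : ℕ} (h : m ≤ n) :
    namesList v e m ⊆ namesList v e n := fun x hx => by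
  rw [mem_namesList] at hx ⊢
  exact hx.imp fun i hi => ⟨hi.1.trans_le h, hi.2⟩

theorem names_mem_candidates (v : Fin 3 → E → V) (e : ℕ → E) (n : ℕ) :
    names v e n ∈ candidates (namesList v e n) := by
  have key (c : Fin 3) (f : Triple → ℕ) (hf : ∀ i, f (names v e i) = firstIndex (v c ∘ e) i) :
      firstIndex (v c ∘ e) n ∈
        (namesList v e n).length :: ((namesList v e n).map f).dedup := by
    rw [length_namesList, List.mem_cons, List.mem_dedup, List.mem_map]
    refine (firstIndex_eq_self_or (v c ∘ e) n).imp id ?_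
    rintro ⟨i, hi, h⟩
    exact ⟨names v e i, mem_namesList.2 ⟨i, hi, rfl⟩, (hf i).trans h⟩
  simp only [candidates, names, List.pair_mem_product]
  exact ⟨key 0 _ fun _ => rfl, key 1 _ fun _ => rfl, key 2 _ fun _ => rfl⟩

theorem isCompatible_names {v : Fin 3 → E → V} (hv : IsSparse v) {e : ℕ → E} {n : ℕ}
    (he : ∀ i < n, e i ≠ e n) : isCompatible (namesList v e n) (names v e n) = true := by
  simp only [isCompatible, List.all_eq_true, mem_namesList, Bool.and_eq_true,
    Bool.not_eq_true', ← Bool.not_eq_true, meetTwice, isTriangle, Bool.or_eq_true, beq_iff_eq]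
  rintro _ ⟨i, hi, rfl⟩
  simp only [names, firstIndex_eq_iff, Function.comp_apply]
  refine ⟨?_, ?_⟩
  · rintro ((h | h) | h)
    · exact he i hi (hv.linear 0 1 (by decide) _ _ h.1 h.2).symm
    · exact he i hi (hv.linear 1 2 (by decide) _ _ h.1 h.2).symm
    · exact he i hi (hv.linear 2 0 (by decide) _ _ h.1 h.2).symm
  · rintro _ ⟨j, hj, rfl⟩
    simp only [firstIndex_eq_iff, Function.comp_apply]
    refine ⟨⟨?_, ?_⟩, ?_⟩
    · exact fun h => he i hi (hv.triangle _ _ _ h.1.1 h.1.2 h.2).symm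
    · -- The condition yields `e i = e j`, so that `e n` meets this edge in two parts.
      intro h
      have hij := hv.triangle _ _ _ h.1.1 h.1.2 h.2
      exact he i hi (hv.linear 1 2 (by decide) _ _ (hij ▸ h.1.2) h.2.symm)
    · exact fun h => he j hj (hv.triangle _ _ _ h.1.1 h.1.2 h.2)

theorem not_hasTransversals_names {v : Fin 3 → E → V} (hv : IsSparse v) {e : ℕ → E} {n i j : ℕ}
    (hij : e i ≠ e j) : hasTransversals (namesList v e n) (names v e i) (names v e j) ≠ true := by
  intro h
  simp only [hasTransversals, List.any_eq_true, mem_namesList, Bool.and_eq_true, beq_iff_eq] at h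
  obtain ⟨⟨⟨_, ⟨k₁, -, rfl⟩, h₁⟩, ⟨_, ⟨k₂, -, rfl⟩, h₂⟩⟩, ⟨_, ⟨k₃, -, rfl⟩, h₃⟩⟩ := h
  simp only [names, firstIndex_eq_iff, Function.comp_apply] at h₁ h₂ h₃
  exact hij (hv.transversal _ _ _ _ _ h₁.1 h₁.2 h₂.1 h₂.2 h₃.1 h₃.2)

/-- Soundness of the search: its `n` last steps fail along the edges of a sparse system that span at
most nine vertices. -/
theorem search_namesList_ne_true {v : Fin 3 → E → V} (hv : IsSparse v) {e : ℕ → E} (n j : ℕ)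
    (he : Set.InjOn e (Set.Iio (n + j))) (hcount : vertexCount (namesList v e (n + j)) ≤ 9) :
    search n (namesList v e j) ≠ true := by
  induction n generalizing j with
  | zero =>
    intro h
    simp only [search, List.any_eq_true, mem_namesList, Bool.and_eq_true, Bool.not_eq_true',
      beq_eq_false_iff_ne] at h
    obtain ⟨_, ⟨i, hi, rfl⟩, _, ⟨k, hk, rfl⟩, hne, h⟩ := h
    refine not_hasTransversals_names hv (fun hik => hne ?_) h
    simp only [names, Prod.mk.injEq, firstIndex_eq_iff, Function.comp_apply, hik, and_self]
  | succ n ih =>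
    intro h
    have hj : n + 1 + j = n + (j + 1) := by ring
    rw [hj] at he hcount
    have := List.all_eq_true.1 h _ (names_mem_candidates v e j)
    rw [← namesList_succ, Bool.or_eq_true, Bool.or_eq_true, Nat.ble_eq,
      isCompatible_names hv fun i hi hij => hi.ne (he ?_ ?_ hij)] at this
    · have hle := vertexCount_mono (namesList_subset v e (show j + 1 ≤ n + (j + 1) by omega))
      rcases this with (h | h) | h
      · omega
      · exact absurd h (by decide)
      · exact ih (j + 1) he hcount h
    · simp only [Set.mem_Iio]; omega
    · simp only [Set.mem_Iio]; omega

/-- Five edges of a sparse system span at least ten vertices. -/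
theorem IsSparse.ten_le_sum_card_image [DecidableEq V] {v : Fin 3 → E → V} (hv : IsSparse v)
    {e : ℕ → E} (he : Set.InjOn e (Set.Iio 5)) :
    10 ≤ ∑ c, ((Finset.range 5).image fun i => v c (e i)).card := by
  by_contra! hlt
  refine search_namesList_ne_true hv 5 0 he (Nat.le_of_lt_succ (hlt.trans_eq' ?_)) search_five
  have key (c : Fin 3) (f : Triple → ℕ) (hf : ∀ i, f (names v e i) = firstIndex (v c ∘ e) i) :
      ((namesList v e 5).map f).toFinset.card =
        ((Finset.range 5).image fun i => v c (e i)).card := by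
    have h₁ : ((namesList v e 5).map f).toFinset =
        (Finset.range 5).image (firstIndex (v c ∘ e)) := by
      ext x
      simp [mem_namesList, hf]
    have h₂ : (Finset.range 5).image (fun i => v c (e i)) =
        ((Finset.range 5).image (firstIndex (v c ∘ e))).image (v c ∘ e) := by
      rw [Finset.image_image]
      exact Finset.image_congr fun i _ => (apply_firstIndex (v c ∘ e) i).symm
    rw [h₁, h₂]
    refine (Finset.card_image_of_injOn ?_).symm
    intro x hx y hy hxy
    simp only [Finset.coe_image, Set.mem_image] at hx hy
    obtain ⟨i, -, rfl⟩ := hx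
    obtain ⟨j, -, rfl⟩ := hy
    rw [apply_firstIndex (v c ∘ e), apply_firstIndex (v c ∘ e)] at hxy
    exact firstIndex_eq_iff.2 hxy
  rw [vertexCount_eq, key 0 _ fun _ => rfl, key 1 _ fun _ => rfl, key 2 _ fun _ => rfl,
    Fin.sum_univ_three]

end Names

/-! ### Hypergraphs from sparse systems -/

section Hypergraph

variable {V E : Type*} {n : ℕ}

/-- The vertices of the edge `e`, where `ι (c, x)` is the vertex `x` of the part `c`. -/
def edge (v : Fin 3 → E → V) (ι : Fin 3 × V ↪ Fin n) (e : E) : Set (Fin n) :=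
  Set.range fun c => ι (c, v c e)

/-- The hypergraph on `Fin n` with the edges `edge v ι e`. -/
def toHypergraph (v : Fin 3 → E → V) (ι : Fin 3 × V ↪ Fin n) : Hypergraph (Fin n) where
  vertexSet := Set.univ
  edgeSet := Set.range (edge v ι)
  subset_vertexSet_of_mem_edgeSet' _ _ := Set.subset_univ _

variable {v : Fin 3 → E → V} {ι : Fin 3 × V ↪ Fin n}

theorem mem_edge_iff {c : Fin 3} {x : V} {e : E} : ι (c, x) ∈ edge v ι e ↔ v c e = x := by
  simp only [edge, Set.mem_range, ι.injective.eq_iff, Prod.mk.injEq]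
  exact ⟨by rintro ⟨_, rfl, h⟩; exact h, fun h => ⟨c, rfl, h⟩⟩

theorem edge_injective (hv : IsSparse v) : Function.Injective (edge v ι) := fun e f h => by
  have key (c : Fin 3) : v c e = v c f := by
    have hc : ι (c, v c f) ∈ edge v ι f := mem_edge_iff.2 rfl
    exact mem_edge_iff.1 (h ▸ hc)
  exact hv.linear 0 1 (by decide) e f (key 0) (key 1)

theorem ncard_edgeSet [Finite E] (hv : IsSparse v) :
    (toHypergraph v ι).edgeSet.ncard = Nat.card E := by
  rw [← Set.ncard_univ, ← Set.ncard_image_of_injective _ (edge_injective (ι := ι) hv),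
    Set.image_univ]
  rfl

theorem isGowersLongHypergraph [Finite E] (hv : IsSparse v) :
    IsGowersLongHypergraph n (toHypergraph v ι) := by
  refine ⟨rfl, ?_, ?_, ?_⟩
  · rintro _ ⟨e, rfl⟩
    rw [edge, ← Set.image_univ, Set.ncard_image_of_injective, Set.ncard_univ, Nat.card_fin]
    exact fun c d h => congrArg Prod.fst (ι.injective h)
  · rintro _ ⟨e, rfl⟩ _ ⟨f, rfl⟩ hne
    have hef : e ≠ f := fun h => hne (h ▸ rfl)
    rintro _ ⟨⟨c, rfl⟩, hc⟩ _ ⟨⟨d, rfl⟩, hd⟩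
    by_contra hcd
    exact hef (hv.linear c d (fun h => hcd (h ▸ rfl)) e f (mem_edge_iff.1 hc).symm
      (mem_edge_iff.1 hd).symm)
  · classical
    rintro ⟨X, -, hX, h5⟩
    obtain ⟨S, hS, hS5⟩ := Set.exists_subset_card_eq h5
    have hSfin : S.Finite := Set.finite_of_ncard_ne_zero (by omega)
    obtain ⟨y, hy⟩ : ∃ y : Fin 5 → Set (Fin n), Function.Injective y ∧ ∀ i, y i ∈ S := by
      have := hSfin.to_subtype
      have hc : Nat.card S = 5 := hS5
      exact ⟨fun i => ((Finite.equivFinOfCardEq hc).symm i : S),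
        Subtype.val_injective.comp (Equiv.injective _), fun i => Subtype.coe_prop _⟩
    choose x hx using fun i => (hS (hy.2 i)).1
    have hxX (i : Fin 5) : edge v ι (x i) ⊆ X := hx i ▸ (hS (hy.2 i)).2
    have hxinj : Function.Injective x := fun i j h => hy.1 (by rw [← hx i, ← hx j, h])
    have hten := hv.ten_le_sum_card_image (e := fun i => x (Fin.ofNat 5 i)) (by
      intro i hi j hj h
      have := congrArg Fin.val (hxinj h)
      simpa [Nat.mod_eq_of_lt hi, Nat.mod_eq_of_lt hj] using this)
    -- The pairs of a part and a vertex of some `x i` in it embed into `X`.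
    rw [← Finset.card_sigma] at hten
    have hle := Finset.card_le_card_of_injOn (t := X.toFinset)
      (fun p : (_ : Fin 3) × V => ι (p.1, p.2)) (s := Finset.univ.sigma fun c =>
        (Finset.range 5).image fun i => v c (x (Fin.ofNat 5 i))) (by
        rintro ⟨c, w⟩ hw
        simp only [Finset.coe_sigma, Set.mem_sigma_iff, Finset.mem_coe, Finset.mem_image] at hw
        obtain ⟨-, i, -, rfl⟩ := hw
        simpa using hxX _ (mem_edge_iff.2 rfl)) (by
        rintro ⟨c, w⟩ - ⟨d, u⟩ - h
        have := ι.injective h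
        simp only [Prod.mk.injEq] at this
        obtain ⟨rfl, rfl⟩ := this
        rfl)
    rw [← Set.ncard_eq_toFinset_card'] at hle
    omega

end Hypergraph

/-! ### Powers of a pair of maps into an abelian group -/

/-- The edge `(x, s)` has the vertices `x`, `x + a s` and `x + b s`. -/
def translates {I G : Type*} [AddCommGroup G] (a b : I → G) (c : Fin 3) (e : G × I) : G :=
  ![e.1, e.1 + a e.2, e.1 + b e.2] c

/-- The conditions on `a` and `b` under which the hypergraph of the triples `x`, `x + a s`,
`x + b s` is sparse. They are implications between equations in `G`, hence pass to powers. -/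
structure IsSparsePair {I G : Type*} [AddCommGroup G] (a b : I → G) : Prop where
  left_injective : Function.Injective a
  right_injective : Function.Injective b
  sub_injective : Function.Injective fun s => b s - a s
  triangle : ∀ r s t, a t - a r = b s - b r → s = t
  transversal : ∀ r₁ r₂ r₃ s t, a r₁ - a t = b s - b r₃ →
    b r₂ - a r₂ = a r₁ - a t + b t - a s → s = t ∧ a r₁ = a t

theorem IsSparsePair.pi {I G : Type*} [AddCommGroup G] {a b : I → G} (h : IsSparsePair a b)
    (K : Type*) : IsSparsePair (fun (s : K → I) k => a (s k)) (fun s k => b (s k)) where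
  left_injective _ _ hst := funext fun k => h.left_injective (congrFun hst k)
  right_injective _ _ hst := funext fun k => h.right_injective (congrFun hst k)
  sub_injective _ _ hst := funext fun k => h.sub_injective (congrFun hst k)
  triangle _ _ _ hst := funext fun k => h.triangle _ _ _ (congrFun hst k)
  transversal _ _ _ _ _ h₁ h₂ :=
    have key k := h.transversal _ _ _ _ _ (congrFun h₁ k) (congrFun h₂ k)
    ⟨funext fun k => (key k).1, funext fun k => (key k).2⟩

theorem IsSparsePair.isSparse {I G : Type*} [AddCommGroup G] {a b : I → G}
    (h : IsSparsePair a b) : IsSparse (translates a b) where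
  linear := by
    have h01 (x y : G) (s t : I) (h₁ : x = y) (h₂ : x + a s = y + a t) : (x, s) = (y, t) := by
      subst h₁; rw [h.left_injective (add_left_cancel h₂)]
    have h02 (x y : G) (s t : I) (h₁ : x = y) (h₂ : x + b s = y + b t) : (x, s) = (y, t) := by
      subst h₁; rw [h.right_injective (add_left_cancel h₂)]
    have h12 (x y : G) (s t : I) (h₁ : x + a s = y + a t) (h₂ : x + b s = y + b t) :
        (x, s) = (y, t) := by
      obtain rfl : s = t := h.sub_injective (by
        show b s - a s = b t - a t
        linear_combination (norm := abel) h₂ - h₁)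
      rw [add_right_cancel h₁]
    intro c d hcd ⟨x, s⟩ ⟨y, t⟩ h₁ h₂
    fin_cases c <;> fin_cases d
    · exact absurd rfl hcd
    · exact h01 _ _ _ _ h₁ h₂
    · exact h02 _ _ _ _ h₁ h₂
    · exact h01 _ _ _ _ h₂ h₁
    · exact absurd rfl hcd
    · exact h12 _ _ _ _ h₁ h₂
    · exact h02 _ _ _ _ h₂ h₁
    · exact h12 _ _ _ _ h₂ h₁
    · exact absurd rfl hcd
  triangle := by
    rintro ⟨x, s⟩ ⟨y, t⟩ ⟨z, r⟩ (h₁ : x = y) (h₂ : y + a t = z + a r) (h₃ : z + b r = x + b s)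
    subst h₁
    rw [h.triangle r s t]
    linear_combination (norm := abel) h₂ + h₃
  transversal := by
    rintro ⟨x, s⟩ ⟨y, t⟩ ⟨z₁, r₁⟩ ⟨z₂, r₂⟩ ⟨z₃, r₃⟩ (h₁ : x = z₁) (h₂ : z₁ + a r₁ = y + a t)
      (h₃ : x + a s = z₂ + a r₂) (h₄ : z₂ + b r₂ = y + b t) (h₅ : x + b s = z₃ + b r₃)
      (h₆ : z₃ = y)
    subst h₁ h₆
    obtain ⟨rfl, hr⟩ := h.transversal r₁ r₂ r₃ s t
      (by linear_combination (norm := abel) h₂ - h₅)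
      (by linear_combination (norm := abel) h₃ + h₄ - h₂)
    rw [hr] at h₂
    rw [add_right_cancel h₂]

/-! ### Four pairs of residues modulo twelve -/

/-- The offsets in `ℤ/12` of the second vertices. -/
def offset₁ : Fin 4 → ZMod 12 := ![0, 1, 2, 5]

/-- The offsets in `ℤ/12` of the third vertices. -/
def offset₂ : Fin 4 → ZMod 12 := ![0, 4, 10, 6]

theorem isSparsePair_offset : IsSparsePair offset₁ offset₂ where
  left_injective := by decide
  right_injective := by decide
  sub_injective := by decide
  triangle := by decide +kernel
  transversal := by
    have key : ∀ r₁ r₃ s t, offset₁ r₁ - offset₁ t = offset₂ s - offset₂ r₃ →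
        ∀ r₂, offset₂ r₂ - offset₁ r₂ = offset₁ r₁ - offset₁ t + offset₂ t - offset₁ s →
          s = t ∧ offset₁ r₁ = offset₁ t := by decide +kernel
    exact fun r₁ r₂ r₃ s t h₁ h₂ => key r₁ r₃ s t h₁ r₂ h₂

theorem exists_hypergraph {n k : ℕ} (hk : 3 * 12 ^ k ≤ n) :
    ∃ H : Hypergraph (Fin n), IsGowersLongHypergraph n H ∧ H.edgeSet.ncard = 48 ^ k := by
  have hv := (isSparsePair_offset.pi (Fin k)).isSparse
  obtain ⟨ι⟩ : Nonempty (Fin 3 × (Fin k → ZMod 12) ↪ Fin n) := by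
    apply Function.Embedding.nonempty_of_card_le
    simpa [ZMod.card] using hk
  refine ⟨toHypergraph _ ι, isGowersLongHypergraph hv, ?_⟩
  rw [ncard_edgeSet hv]
  simp [← mul_pow]

/-! ### Growth rates -/

theorem twelve_rpow_le : (12 : ℝ) ^ (1.544 : ℝ) ≤ 47 := by
  have h : ((12 : ℝ) ^ (1.544 : ℝ)) ^ 125 ≤ 47 ^ 125 := by
    rw [← Real.rpow_natCast, ← Real.rpow_mul (by norm_num),
      show (1.544 : ℝ) * (125 : ℕ) = (193 : ℕ) by norm_num, Real.rpow_natCast]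
    norm_num
  exact le_of_pow_le_pow_left₀ (by norm_num) (by norm_num) h

theorem eventually_rpow_le :
    ∀ᶠ n : ℕ in atTop, ∃ k, 3 * 12 ^ k ≤ n ∧ (n : ℝ) ^ (1.544 : ℝ) ≤ 48 ^ k := by
  -- `k` is the largest exponent with `3 * 12 ^ k ≤ n`; the factor `36 ^ 1.544` lost by passing from
  -- `n` to `12 ^ k` is absorbed by `(48 / 47) ^ k`.
  have hgrow : ∀ᶠ k : ℕ in atTop, (36 : ℝ) ^ (1.544 : ℝ) ≤ (48 / 47) ^ k :=
    (tendsto_pow_atTop_atTop_of_one_lt (by norm_num)).eventually_ge_atTop _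
  have hlog : Tendsto (fun n => Nat.log 12 (n / 3)) atTop atTop :=
    (tendsto_atTop.2 fun b => (eventually_ge_atTop (12 ^ b)).mono fun _ =>
      Nat.le_log_of_pow_le (by norm_num)).comp (Nat.tendsto_div_const_atTop (by norm_num))
  filter_upwards [hlog.eventually hgrow, eventually_ge_atTop 3] with n hn h3
  set k := Nat.log 12 (n / 3) with hk
  have hlow : 12 ^ k ≤ n / 3 := Nat.pow_log_le_self 12 (by omega)
  have hupp : n / 3 < 12 ^ (k + 1) := Nat.lt_pow_succ_log_self (by norm_num) _
  refine ⟨k, by omega, ?_⟩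
  have hn' : (n : ℝ) ≤ 36 * 12 ^ k := by
    have : n ≤ 36 * 12 ^ k := by rw [pow_succ] at hupp; omega
    exact_mod_cast this
  calc (n : ℝ) ^ (1.544 : ℝ) ≤ (36 * 12 ^ k) ^ (1.544 : ℝ) :=
        Real.rpow_le_rpow (by positivity) hn' (by norm_num)
    _ = 36 ^ (1.544 : ℝ) * (12 ^ (1.544 : ℝ)) ^ k := by
        rw [Real.mul_rpow (by norm_num) (by positivity), Real.rpow_pow_comm (by norm_num)]
    _ ≤ (48 / 47) ^ k * 47 ^ k := by
        gcongr
        exact twelve_rpow_le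
    _ = 48 ^ k := by rw [← mul_pow]; norm_num

theorem le_of_eventually_rpow_le {s t C : ℝ}
    (h : ∀ᶠ n : ℕ in atTop, (n : ℝ) ^ s ≤ C * (n : ℝ) ^ t) : s ≤ t := by
  by_contra! hlt
  have hlim : Tendsto (fun n : ℕ => (n : ℝ) ^ (s - t)) atTop atTop :=
    (tendsto_rpow_atTop (sub_pos.2 hlt)).comp tendsto_natCast_atTop_atTop
  obtain ⟨n, hn, hC, hpos⟩ :=
    (h.and ((hlim.eventually_gt_atTop C).and (eventually_gt_atTop 0))).exists
  have hpos : (0 : ℝ) < n := Nat.cast_pos.2 hpos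
  rw [Real.rpow_sub hpos, lt_div_iff₀ (Real.rpow_pos_of_pos hpos t)] at hC
  exact hC.not_ge hn

end Tripartite

theorem mainTheorem4 :
    (∀ᶠ n : ℕ in atTop, ∃ H : Hypergraph (Fin n), IsGowersLongHypergraph n H ∧
      (n : ℝ) ^ (1.544 : ℝ) ≤ (H.edgeSet.ncard : ℝ)) ∧
    (∀ c : ℝ, GowersLongBound c → c ≤ 0.456) := by
  have hmany : ∀ᶠ n : ℕ in atTop, ∃ H : Hypergraph (Fin n), IsGowersLongHypergraph n H ∧
      (n : ℝ) ^ (1.544 : ℝ) ≤ (H.edgeSet.ncard : ℝ) := by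
    filter_upwards [Tripartite.eventually_rpow_le] with n ⟨k, hk, hle⟩
    obtain ⟨H, hH, hcard⟩ := Tripartite.exists_hypergraph hk
    exact ⟨H, hH, by rw [hcard]; exact_mod_cast hle⟩
  refine ⟨hmany, fun c ⟨C, hC⟩ => ?_⟩
  have : (1.544 : ℝ) ≤ 2 - c := by
    refine Tripartite.le_of_eventually_rpow_le (C := C) ?_
    filter_upwards [hmany, hC] with n ⟨H, hH, hle⟩ hn
    exact hle.trans (hn H hH)
  norm_num at this ⊢
  linarith
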